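/- Let $\mathsf X$ be a metric space, let $\mathsf Z$ be a compact metric space, and put $\mathsf S=\mathsf X\times\mathsf Z$ (all with their Borel $\sigma$-algebras). Let $\{K_j\}_{j\ge 1}$ be a strictly increasing sequence of compact subsets of $\mathsf X$ with $\mathsf X=\bigcup_j \operatorname{Int}(K_j)$. Let $\Gamma$ be a correspondence assigning to each $(x,z)\in\mathsf S$ a set $\Gamma(x,z)\subset\mathsf X$ of feasible actions, let $u$ be a real function on the graph of $\Gamma$, let $\beta:\mathsf Z\to[0,\infty)$ be bounded, let $Q$ be a Markov transition kernel on $\mathsf Z$, and put $$H(x,z,a,v)=u(x,z,a)+\beta(z)\int_{\mathsf Z} v(a,z')\,Q(z,dz').$$ A feasible policy is a Borel map $\sigma:\mathsf S\to\mathsf X$ with $\sigma(x,z)\in\Gamma(x,z)$ for all $(x,z)$; $\Sigma$ is the set of feasible policies. Put $(T_\sigma v)(x,z)=H(x,z,\sigma(x,z),v)$ and $(Tv)(x,z)=\sup_{a\in\Gamma(x,z)}H(x,z,a,v)$. Given a set $\mathcal V$ of candidate value functions, the lifetime value of $\sigma$ is $v_\sigma(x,z)=\lim_{n\to\infty}(T_\sigma^n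 v_0)(x,z)$; it is well defined if for each $v_0\in\mathcal V$ the iterates are well defined and the limit exists, is finite, and does not depend on $v_0\in\mathcal V$. The value function is $v^*(x,z)=\sup_{\sigma\in\Sigma}v_\sigma(x,z)$, and $\sigma\in\Sigma$ is optimal if $v_\sigma=v^*$ on $\mathsf S$. Fix $c>1$. For $f$ continuous on $\mathsf S$ let $\|f\|_j=\sup_{x\in K_j,\,z\in\mathsf Z}|f(x,z)|$, and for an increasing unbounded sequence $m=\{m_j\}$ of positive reals let $$C_m(\mathsf S)=\Big\{f\in C(\mathsf S):\ \|f\|:=\sum_{j=1}^\infty \frac{\|f\|_j}{m_jc^j}<\infty\Big\}.$$ Assume that $\Gamma$ is continuous (upper and lower hemicontinuous), nonempty-valued and compact-valued; $u$ and $\beta$ are continuous; $Q$ is Feller (that is, $z\mapsto\int f(z')\,Q(z,dz')$ is bounded and continuous for every bounded continuous $f$); $\Gamma(x,z)\subset K_j$ for all $x\in K_j$, $z\in\mathsf Z$ and all $j$; and $r(L_\beta)<1$, where $(L_\beta h)(z)=\beta(z)\int h(z')\,Q(z,dz')$ acts on the bounded measurable functions on $\mathsf Z$ with the supremum norm and $r(L_\beta)=\lim_{n}\|L_\beta^n\|^{1/n}$.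 Then, with $\mathcal V=C_m(\mathsf S)$: 1. For every such sequence $m$ and every $\sigma\in\Sigma$, the lifetime value $v_\sigma$ is well defined and finite at every state, and it does not depend on the choice of $m$; the value function $v^*$ exists and is finite. 2. There is an increasing unbounded sequence $\{m_j\}$ of positive reals such that $T$ maps $C_m(\mathsf S)$ into itself, $v^*$ is the unique fixed point of $T$ in $C_m(\mathsf S)$, and $\|T^nv-v^*\|\to0$ for all $v\in C_m(\mathsf S)$. 3. There exists an optimal (stationary) policy $\sigma\in\Sigma$. 4. (Principle of optimality) A policy $\sigma\in\Sigma$ is optimal if and only if $\sigma(x,z)\in\operatorname{argmax}_{a\in\Gamma(x,z)}H(x,z,a,v^*)$ for every $(x,z)\in\mathsf S$. -/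

import Mathlib

open Set Filter Topology MeasureTheory ProbabilityTheory
open scoped ENNReal BoundedContinuousFunction

/-! ### Bounded measurable functions, the discount operator and its spectral radius -/

/-- The space of bounded measurable functions `Z → ℝ` with the supremum norm, as a subspace of
the space `ℓ^∞(Z)` of all bounded functions. -/
abbrev BddMeas (Z : Type*) [MeasurableSpace Z] : Type _ :=
  ({ carrier := {f : lp (fun _ : Z => ℝ) ∞ | Measurable (fun z => f z)}
     add_mem' := fun {f g} hf hg => by
       have h : Measurable (fun z => f z + g z) := Measurable.add hf hg
       simpa using h
     zero_mem' := by
       simp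
     smul_mem' := fun c f hf => by
       have h : Measurable (fun z => c * f z) := Measurable.const_mul hf c
       simpa using h } : Submodule ℝ (lp (fun _ : Z => ℝ) ∞))

namespace BddMeas

variable {Z : Type*} [MeasurableSpace Z]

instance : CoeFun (BddMeas Z) (fun _ => Z → ℝ) := ⟨fun f z => f.1 z⟩

theorem measurable (f : BddMeas Z) : Measurable (fun z => f z) := f.2

theorem abs_le_norm (f : BddMeas Z) (z : Z) : |f z| ≤ ‖f‖ :=
  lp.norm_apply_le_norm (p := ∞) ENNReal.top_ne_zero f.1 z

theorem norm_le_of (f : BddMeas Z) {C : ℝ} (hC : 0 ≤ C) (h : ∀ z, |f z| ≤ C) : ‖f‖ ≤ C :=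
  lp.norm_le_of_forall_le hC h

/-- A measurable function with a uniform bound, as an element of `BddMeas Z`. -/
def mk (f : Z → ℝ) (hf : Measurable f) (C : ℝ) (hC : ∀ z, |f z| ≤ C) : BddMeas Z :=
  ⟨⟨f, memℓp_infty ⟨C, by rintro _ ⟨z, rfl⟩; exact hC z⟩⟩, hf⟩

@[simp] theorem mk_apply (f : Z → ℝ) (hf : Measurable f) (C : ℝ) (hC : ∀ z, |f z| ≤ C) (z : Z) :
    mk f hf C hC z = f z := rfl

theorem ext_fun {f g : BddMeas Z} (h : ∀ z, f z = g z) : f = g :=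
  Subtype.ext (lp.ext (funext h))

theorem integrable (f : BddMeas Z) (μ : Measure Z) [IsFiniteMeasure μ] :
    Integrable (fun z => f z) μ :=
  Integrable.of_bound f.measurable.aestronglyMeasurable ‖f‖
    (Eventually.of_forall fun z => f.abs_le_norm z)

theorem abs_integral_le (f : BddMeas Z) (μ : Measure Z) [IsProbabilityMeasure μ] :
    |∫ z, f z ∂μ| ≤ ‖f‖ := by
  have h := norm_integral_le_of_norm_le_const (μ := μ) (f := fun z => f z) (C := ‖f‖)
    (Eventually.of_forall fun z => f.abs_le_norm z)
  simpa using h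

theorem abs_discount_le (Q : Kernel Z Z) [IsMarkovKernel Q] (β h : BddMeas Z) (z : Z) :
    |β z * ∫ z', h z' ∂(Q z)| ≤ ‖β‖ * ‖h‖ := by
  rw [abs_mul]
  exact mul_le_mul (β.abs_le_norm z) (h.abs_integral_le (Q z)) (abs_nonneg _) (norm_nonneg _)

end BddMeas

/-- The operator `(L_β h)(z) = β(z) ∫ h(z') Q(z, dz')` on bounded measurable functions. -/
noncomputable def discountOp {Z : Type*} [MeasurableSpace Z] (Q : Kernel Z Z) [IsMarkovKernel Q]
    (β : BddMeas Z) : BddMeas Z →L[ℝ] BddMeas Z :=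
  LinearMap.mkContinuous
    { toFun := fun h => BddMeas.mk (fun z => β z * ∫ z', h z' ∂(Q z))
        (β.measurable.mul
          (MeasureTheory.StronglyMeasurable.integral_kernel (κ := Q)
            h.measurable.stronglyMeasurable).measurable)
        (‖β‖ * ‖h‖) (BddMeas.abs_discount_le Q β h)
      map_add' := fun f g => BddMeas.ext_fun fun z => by
        have h : ∫ z', (f z' + g z') ∂(Q z) = ∫ z', f z' ∂(Q z) + ∫ z', g z' ∂(Q z) :=
          integral_add (f.integrable _) (g.integrable _)
        change β z * ∫ z', (f z' + g z') ∂(Q z)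
          = β z * (∫ z', f z' ∂(Q z)) + β z * ∫ z', g z' ∂(Q z)
        rw [h, mul_add]
      map_smul' := fun c f => BddMeas.ext_fun fun z => by
        have h : ∫ z', (c * f z') ∂(Q z) = c * ∫ z', f z' ∂(Q z) := integral_const_mul c _
        change β z * ∫ z', (c * f z') ∂(Q z) = c * (β z * ∫ z', f z' ∂(Q z))
        rw [h]; ring }
    ‖β‖
    (fun h => BddMeas.norm_le_of _ (mul_nonneg (norm_nonneg _) (norm_nonneg _))
      (BddMeas.abs_discount_le Q β h))

theorem discountOp_apply {Z : Type*} [MeasurableSpace Z] (Q : Kernel Z Z) [IsMarkovKernel Q]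
    (β h : BddMeas Z) (z : Z) : discountOp Q β h z = β z * ∫ z', h z' ∂(Q z) := rfl

/-- `r` is the spectral radius of the bounded operator `L`: `r = lim_n ‖L ^ n‖ ^ (1 / n)`
(the limit always exists). -/
def IsSpectralRadius {E : Type*} [NormedAddCommGroup E] [NormedSpace ℝ E] (L : E →L[ℝ] E)
    (r : ℝ) : Prop :=
  Tendsto (fun n : ℕ => ‖L ^ n‖ ^ (1 / (n : ℝ))) atTop (𝓝 r)

/-- The Feller property: `z ↦ ∫ f(z') Q(z, dz')` is continuous for every bounded continuous `f`
(for a Markov kernel it is then automatically bounded). -/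
def IsFeller {Z : Type*} [TopologicalSpace Z] [MeasurableSpace Z] (Q : Kernel Z Z) : Prop :=
  ∀ f : Z →ᵇ ℝ, Continuous (fun z => ∫ z', f z' ∂(Q z))

/-! ### Dynamic programs

`S` is the state space, `A` the action space, `Γ` the feasible correspondence,
`H s a v` the continuation aggregator. -/

section DynamicProgram

variable {S A : Type*}

/-- The graph of the feasible correspondence: all feasible state-action pairs. -/
def feasibleGraph (Γ : S → Set A) : Set (S × A) := {p | p.2 ∈ Γ p.1}

/-- The feasible (stationary) policies: measurable selections of `Γ`. -/
def feasiblePolicies [MeasurableSpace S] [MeasurableSpace A] (Γ : S → Set A) : Set (S → A) :=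
  {σ | Measurable σ ∧ ∀ s, σ s ∈ Γ s}

/-- The policy operator `T_σ`. -/
def policyOp (H : S → A → (S → ℝ) → ℝ) (σ : S → A) (v : S → ℝ) : S → ℝ :=
  fun s => H s (σ s) v

/-- The Bellman operator `T`. -/
noncomputable def bellmanOp (H : S → A → (S → ℝ) → ℝ) (Γ : S → Set A) (v : S → ℝ) : S → ℝ :=
  fun s => sSup ((fun a => H s a v) '' Γ s)

/-- `w` is the `σ`-value function when `V` is the set of candidate value functions: from every
initial `v₀ ∈ V` the iterates `T_σ^n v₀` converge pointwise to `w`. -/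
def IsPolicyValue (H : S → A → (S → ℝ) → ℝ) (V : Set (S → ℝ)) (σ : S → A) (w : S → ℝ) : Prop :=
  ∀ v₀ ∈ V, ∀ s, Tendsto (fun n : ℕ => ((policyOp H σ)^[n] v₀) s) atTop (𝓝 (w s))

end DynamicProgram

/-- The additively separable aggregator
`H(x, z, a, v) = u(x, z, a) + β(z) ∫ v(a, z') Q(z, dz')`, with action space equal to `X`. -/
noncomputable def separableAggregator {X Z : Type*} [MeasurableSpace Z]
    (u : (X × Z) × X → ℝ) (β : Z → ℝ) (Q : Kernel Z Z) :
    X × Z → X → (X × Z → ℝ) → ℝ :=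
  fun s a v => u (s, a) + β s.2 * ∫ z', v (a, z') ∂(Q s.2)

/-! ### The weighted space `C_m(S)`

The sequences are indexed by `ℕ` from `0`, so that `K j`, `m j` are the objects that carry the
index `j + 1` when counting starts from `1`; hence the weight `c ^ (j + 1)`. -/

section Weighted

variable {X Z : Type*}

/-- `‖f‖_j = sup_{x ∈ K_j, z ∈ Z} |f(x, z)|`. -/
noncomputable def localNorm (K : ℕ → Set X) (j : ℕ) (f : X × Z → ℝ) : ℝ :=
  sSup ((fun s => |f s|) '' (K j ×ˢ (univ : Set Z)))

/-- `‖f‖ = ∑_j ‖f‖_j / (m_j c^j)`. -/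
noncomputable def weightedNorm (K : ℕ → Set X) (c : ℝ) (m : ℕ → ℝ) (f : X × Z → ℝ) : ℝ :=
  ∑' j, localNorm K j f / (m j * c ^ (j + 1))

/-- `C_m(S)`: the continuous functions on `S = X × Z` with `∑_j ‖f‖_j / (m_j c^j) < ∞`. -/
def weightedSpace [TopologicalSpace X] [TopologicalSpace Z] (K : ℕ → Set X) (c : ℝ)
    (m : ℕ → ℝ) : Set (X × Z → ℝ) :=
  {f | Continuous f ∧ Summable (fun j => localNorm K j f / (m j * c ^ (j + 1)))}

end Weighted

/-- An increasing unbounded sequence of positive reals. -/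
def IsWeightSeq (m : ℕ → ℝ) : Prop :=
  (∀ j, 0 < m j) ∧ StrictMono m ∧ Tendsto m atTop atTop

/-! Feasible actions never leave `K j`, so each `K j × Z` carries its own subproblem. If `|v - w| ≤
h(z)` there, the images under `T_σ`, and under `T`, differ by at most `L_β h`. Hence n-th iterates
differ by at most `‖L_β ^ n‖` times the initial gap. One step need not contract, but `r(L_β) < 1`
makes these norms summable, which gives convergence uniform on every `K j × Z`
(`IsDominated.exists_limit`).

For `T` on continuous functions (Berge's theorem and the Feller property keep `T v` continuous), the
iterates of `0` tend to a continuous fixed point `w` with `‖w‖_j ≤ (∑ ‖L_β ^ k‖) ‖T 0‖_j`.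
Completeness of `C_m` is never needed: once `m` is chosen with `T 0 ∈ C_m`, that bound puts `w` in
`C_m`.

`T_σ` acts on measurable functions bounded on each `K j × Z`. This class contains every `C_m`, so
lifetime values do not depend on `m`. Monotonicity gives `v_σ ≤ T_σ w ≤ w`, so `v_σ = w` exactly
when `T_σ w = w`, that is, when `σ` is greedy for `w`. A measurable selection of the argmax
correspondence is such a policy, so `w = v^*`. -/

/-- The root test for powers of an operator with spectral radius less than one. -/
theorem IsSpectralRadius.summable_norm_pow {E : Type*} [NormedAddCommGroup E] [NormedSpace ℝ E]
    {L : E →L[ℝ] E} {r : ℝ} (hr : IsSpectralRadius L r) (hr_lt : r < 1) :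
    Summable (fun n => ‖L ^ n‖) := by
  have hr0 : 0 ≤ r := ge_of_tendsto' hr fun n => Real.rpow_nonneg (norm_nonneg _) _
  obtain ⟨ρ, hrρ, hρ⟩ := exists_between hr_lt
  have hρ0 : 0 ≤ ρ := hr0.trans hrρ.le
  refine Summable.of_norm_bounded_eventually_nat (summable_geometric_of_lt_one hρ0 hρ) ?_
  filter_upwards [hr.eventually_lt_const hrρ, eventually_gt_atTop 0] with n hn hn0
  rw [norm_norm]
  calc ‖L ^ n‖ = (‖L ^ n‖ ^ (1 / (n : ℝ))) ^ n := by
        rw [one_div, Real.rpow_inv_natCast_pow (norm_nonneg _) hn0.ne']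
    _ ≤ ρ ^ n := pow_le_pow_left₀ (Real.rpow_nonneg (norm_nonneg _) _) hn.le n

/-! ### Measurable selection by successive nearest points. -/

section Selection

variable {S X : Type*}

/-- The points of `G s` that are closest to `d`. -/
def closestPoints [PseudoEMetricSpace X] (G : S → Set X) (d : X) (s : S) : Set X :=
  {a ∈ G s | ∀ b ∈ G s, edist a d ≤ edist b d}

variable [MetricSpace X]

theorem closestPoints_nonempty {G : S → Set X} {s : S} (hc : IsCompact (G s))
    (hn : (G s).Nonempty) (d : X) : (closestPoints G d s).Nonempty := by
  obtain ⟨a, ha, hmin⟩ := hc.exists_isMinOn hn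
    (f := fun a => edist a d) (continuous_id.edist continuous_const).continuousOn
  exact ⟨a, ha, fun b hb => hmin hb⟩

theorem isCompact_closestPoints {G : S → Set X} {s : S} (hc : IsCompact (G s)) (d : X) :
    IsCompact (closestPoints G d s) := by
  have : closestPoints G d s = G s ∩ ⋂ b ∈ G s, {a | edist a d ≤ edist b d} := by
    ext a; simp [closestPoints]
  rw [this]
  refine hc.inter_right (isClosed_biInter fun b _ => ?_)
  exact isClosed_le (continuous_id.edist continuous_const) continuous_const

/-- Measurability of a correspondence, tested on closed sets, passes to its closest points. -/
theorem measurableSet_closestPoints_inter [MeasurableSpace S] {G : S → Set X}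
    (hc : ∀ s, IsCompact (G s))
    (hm : ∀ F, IsClosed F → MeasurableSet {s | (G s ∩ F).Nonempty}) (d : X)
    {F : Set X} (hF : IsClosed F) : MeasurableSet {s | (closestPoints G d s ∩ F).Nonempty} := by
  -- The distance from `d` to `G s ∩ F`, equal to `∞` when that set is empty.
  let φ : Set X → S → ℝ≥0∞ := fun F s => ⨅ a ∈ G s ∩ F, edist a d
  have hle : ∀ F s a, a ∈ G s ∩ F → φ F s ≤ edist a d := fun F s a ha => iInf₂_le a ha
  have hatt : ∀ {F}, IsClosed F → ∀ s, (G s ∩ F).Nonempty →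
      ∃ a ∈ G s ∩ F, edist a d = φ F s := by
    intro F hF s hs
    obtain ⟨a, ha, hmin⟩ := ((hc s).inter_right hF).exists_isMinOn hs
      (f := fun a => edist a d) (continuous_id.edist continuous_const).continuousOn
    exact ⟨a, ha, le_antisymm (le_iInf₂ fun b hb => hmin hb) (iInf₂_le a ha)⟩
  have hφ : ∀ {F}, IsClosed F → Measurable (φ F) := by
    intro F hF
    refine measurable_of_Iic fun t => ?_
    by_cases ht : t = ∞
    · simp [ht]
    have : φ F ⁻¹' Iic t = {s | (G s ∩ (F ∩ Metric.closedEBall d t)).Nonempty} := by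
      ext s
      constructor
      · intro h
        have hne : (G s ∩ F).Nonempty := by
          by_contra hne
          rw [not_nonempty_iff_eq_empty] at hne
          have : φ F s = ∞ := by simp only [φ, hne, mem_empty_iff_false, iInf_false, iInf_top]
          rw [mem_preimage, this, mem_Iic, top_le_iff] at h
          exact ht h
        obtain ⟨a, ha, hea⟩ := hatt hF s hne
        exact ⟨a, ha.1, ha.2, by rw [Metric.mem_closedEBall, hea]; exact h⟩
      · rintro ⟨a, ha, haF, hat⟩
        exact (hle F s a ⟨ha, haF⟩).trans hat
    rw [this]
    exact hm _ (hF.inter Metric.isClosed_closedEBall)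
  -- `F` contains a closest point iff restricting to `F` does not increase the distance.
  -- Nonemptiness is required separately, since both distances are `∞` when `G s` is empty.
  have : {s | (closestPoints G d s ∩ F).Nonempty}
      = {s | (G s ∩ F).Nonempty} ∩ {s | φ F s ≤ φ univ s} := by
    ext s
    constructor
    · rintro ⟨a, ⟨ha, hmin⟩, haF⟩
      exact ⟨⟨a, ha, haF⟩, (hle F s a ⟨ha, haF⟩).trans (le_iInf₂ fun b hb => hmin b hb.1)⟩
    · rintro ⟨h1, h2⟩
      obtain ⟨a, ha, hea⟩ := hatt hF s h1
      refine ⟨a, ⟨ha.1, fun b hb => ?_⟩, ha.2⟩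
      rw [hea]
      exact h2.trans (hle univ s b ⟨hb, mem_univ b⟩)
  rw [this]
  exact (hm F hF).inter (measurableSet_le (hφ hF) (hφ isClosed_univ))

/-- A measurable correspondence with nonempty compact values in a separable metric space has a
measurable selection. -/
theorem exists_measurable_selection [MeasurableSpace S] [MeasurableSpace X] [BorelSpace X]
    [TopologicalSpace.SeparableSpace X] {G : S → Set X}
    (hc : ∀ s, IsCompact (G s)) (hn : ∀ s, (G s).Nonempty)
    (hm : ∀ F, IsClosed F → MeasurableSet {s | (G s ∩ F).Nonempty}) :
    ∃ σ : S → X, Measurable σ ∧ ∀ s, σ s ∈ G s := by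
  rcases isEmpty_or_nonempty X with hX | hX
  · have : IsEmpty S := ⟨fun s => hX.elim (hn s).some⟩
    exact ⟨isEmptyElim, measurable_of_empty _, isEmptyElim⟩
  let d := TopologicalSpace.denseSeq X
  -- Keep the points nearest to `d 0`, then among them those nearest to `d 1`, and so on. Survivors
  -- have equal distances to a dense sequence, so only one point remains.
  let R : ℕ → S → Set X := fun n => Nat.rec G (fun n R => closestPoints R (d n)) n
  have hR : ∀ n, (∀ s, IsCompact (R n s)) ∧ (∀ s, (R n s).Nonempty) ∧
      ∀ F, IsClosed F → MeasurableSet {s | (R n s ∩ F).Nonempty} := by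
    intro n
    induction n with
    | zero => exact ⟨hc, hn, hm⟩
    | succ n ih =>
      obtain ⟨h1, h2, h3⟩ := ih
      exact ⟨fun s => isCompact_closestPoints (h1 s) _, fun s => closestPoints_nonempty (h1 s)
        (h2 s) _, fun F hF => measurableSet_closestPoints_inter h1 h3 _ hF⟩
  have hanti : ∀ n s, R (n + 1) s ⊆ R n s := fun n s a ha => ha.1
  have hinter : ∀ s F, IsClosed F → (∀ n, (R n s ∩ F).Nonempty) → (⋂ n, R n s ∩ F).Nonempty :=
    fun s F hF h => IsCompact.nonempty_iInter_of_sequence_nonempty_isCompact_isClosed _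
      (fun n => inter_subset_inter_left _ (hanti n s)) h (((hR 0).1 s).inter_right hF)
      fun n => ((hR n).1 s).isClosed.inter hF
  have hsel : ∀ s, ∃ a, ∀ n, a ∈ R n s := fun s => by
    obtain ⟨a, ha⟩ := hinter s univ isClosed_univ fun n => by simpa using (hR n).2.1 s
    exact ⟨a, fun n => (mem_iInter.1 ha n).1⟩
  have huniq : ∀ s a b, (∀ n, a ∈ R n s) → (∀ n, b ∈ R n s) → a = b := by
    intro s a b ha hb
    have hab : ∀ x : X, edist a x = edist b x := by
      have hcl : IsClosed {x : X | edist a x = edist b x} :=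
        isClosed_eq (continuous_const.edist continuous_id) (continuous_const.edist continuous_id)
      refine fun x => (TopologicalSpace.denseRange_denseSeq X).induction_on x hcl fun n => ?_
      exact le_antisymm ((ha (n + 1)).2 b (hb n)) ((hb (n + 1)).2 a (ha n))
    have := hab a
    rw [edist_self] at this
    exact (edist_eq_zero.1 this.symm).symm
  choose σ hσ using hsel
  refine ⟨σ, measurable_of_isClosed fun F hF => ?_, fun s => hσ s 0⟩
  -- By Cantor's intersection theorem, if every `R n s` meets `F`, then so does their intersection,
  -- which is `{σ s}`.
  have : σ ⁻¹' F = ⋂ n, {s | (R n s ∩ F).Nonempty} := by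
    ext s
    rw [mem_iInter]
    constructor
    · exact fun h n => ⟨σ s, hσ s n, h⟩
    · intro h
      obtain ⟨a, ha⟩ := hinter s F hF h
      rw [mem_iInter] at ha
      rw [mem_preimage, huniq s (σ s) a (hσ s) fun n => (ha n).1]
      exact (ha 0).2
  rw [this]
  exact MeasurableSet.iInter fun n => (hR n).2.2 F hF

end Selection

/-! ### Berge's maximum theorem. -/

section Maximum

variable {S X : Type*} [TopologicalSpace S] [TopologicalSpace X] {Γ : S → Set X}

theorem ContinuousOn.feasibleGraph_section {h : S × X → ℝ} (hh : ContinuousOn h (feasibleGraph Γ))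
    (s : S) : ContinuousOn (fun a => h (s, a)) (Γ s) :=
  hh.comp (Continuous.prodMk_right s).continuousOn fun _ ha => ha

theorem isGreatest_sSup_image_of_isCompact {f : X → ℝ} {A : Set X} (hA : IsCompact A)
    (hne : A.Nonempty) (hf : ContinuousOn f A) : IsGreatest (f '' A) (sSup (f '' A)) :=
  (hA.image_of_continuousOn hf).isGreatest_sSup (hne.image f)

/-- Continuity of the value in Berge's maximum theorem. -/
theorem continuous_sSup_image_of_hemicontinuous (huhc : UpperHemicontinuous Γ)
    (hlhc : LowerHemicontinuous Γ) (hne : ∀ s, (Γ s).Nonempty) (hc : ∀ s, IsCompact (Γ s))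
    {h : S × X → ℝ} (hh : ContinuousOn h (feasibleGraph Γ)) :
    Continuous fun s => sSup ((fun a => h (s, a)) '' Γ s) := by
  have hmax := fun s =>
    isGreatest_sSup_image_of_isCompact (hc s) (hne s) (hh.feasibleGraph_section s)
  refine continuous_iff_continuousAt.2 fun s₀ => tendsto_order.2 ⟨fun y hy => ?_, fun y hy => ?_⟩
  -- Lower semicontinuity: lower hemicontinuity supplies feasible actions close to a maximizer over
  -- `s₀`.
  · obtain ⟨a₀, ha₀, heq⟩ := (hmax s₀).1
    replace hy : y < h (s₀, a₀) := hy.trans_eq heq.symm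
    have hev : ∀ᶠ p in 𝓝 (s₀, a₀), p ∈ feasibleGraph Γ → y < h p :=
      eventually_nhdsWithin_iff.1 ((hh (s₀, a₀) ha₀).eventually_const_lt hy)
    rw [nhds_prod_eq, eventually_prod_iff] at hev
    obtain ⟨p, hp, q, hq, hpq⟩ := hev
    obtain ⟨W, hW, hWo, haW⟩ := eventually_nhds_iff.1 hq
    filter_upwards [hp, lowerHemicontinuousAt_iff.1 (hlhc s₀) W hWo ⟨a₀, ha₀, haW⟩]
      with s hs hsW
    obtain ⟨a, ha, haW⟩ := hsW
    exact (hpq hs (hW a haW) ha).trans_le ((hmax s).2 ⟨a, ha, rfl⟩)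
  -- Upper semicontinuity: a tube around `{s₀} × Γ s₀`. Since `h` is controlled only on the graph,
  -- `U` comes from an implication.
  · let U : Set (S × X) := interior {p | p ∈ feasibleGraph Γ → h p < y}
    have hU : ({s₀} : Set S) ×ˢ Γ s₀ ⊆ U := by
      rintro ⟨s, a⟩ ⟨rfl, ha⟩
      refine mem_interior_iff_mem_nhds.2 (eventually_nhdsWithin_iff.1 ?_)
      exact (hh (_, a) ha).eventually_lt_const (((hmax _).2 ⟨a, ha, rfl⟩).trans_lt hy)
    obtain ⟨V, W, hVo, hWo, hV, hW, hVW⟩ :=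
      generalized_tube_lemma isCompact_singleton (hc s₀) isOpen_interior hU
    filter_upwards [hVo.mem_nhds (hV rfl), huhc.forall_isOpen s₀ W hWo hW] with s hs hsW
    obtain ⟨a, ha, heq⟩ := (hmax s).1
    rw [← heq]
    exact interior_subset (hVW ⟨hs, hsW ha⟩ : (s, a) ∈ U) ha

theorem isClosed_feasibleGraph [RegularSpace X] (huhc : UpperHemicontinuous Γ)
    (hc : ∀ s, IsClosed (Γ s)) : IsClosed (feasibleGraph Γ) := by
  refine isClosed_iff_frequently.2 fun p hp => ?_
  exact (huhc.upperHemicontinuousAt p.1).mem_of_tendsto (hc _) (x := Prod.fst)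
    (y := Prod.snd) (l := 𝓝 p) continuous_fst.continuousAt hp continuous_snd.continuousAt

end Maximum

/-! ### Instances for the space of bounded measurable functions. -/

namespace BddMeas

variable {Z : Type*} [MeasurableSpace Z]

/-- The norm of `BddMeas Z`, as a direct instance: the search for it is slow. -/
@[reducible] noncomputable def seminormedAddCommGroup : SeminormedAddCommGroup (BddMeas Z) :=
  (Submodule.normedAddCommGroup _).toSeminormedAddCommGroup

attribute [local instance] seminormedAddCommGroup in
/-- The normed space structure of `BddMeas Z`, as a direct instance. -/
@[reducible] noncomputable def normedSpace : NormedSpace ℝ (BddMeas Z) :=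
  Submodule.normedSpace _

attribute [local instance] seminormedAddCommGroup normedSpace in
/-- The multiplicative structure of the operators on `BddMeas Z`, as a direct instance. -/
@[reducible] noncomputable def monoidEnd : Monoid (BddMeas Z →L[ℝ] BddMeas Z) :=
  ContinuousLinearMap.monoidWithZero.toMonoid

end BddMeas

/-! ### Iteration of operators dominated by a linear one. -/

section Iteration

attribute [local instance] BddMeas.seminormedAddCommGroup BddMeas.normedSpace
  BddMeas.monoidEnd

variable {X Z : Type*} [MeasurableSpace Z]

/-- `A` preserves `V`, and on every `K j × Z` a bound `h` on the difference of two elements of `V`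
becomes the bound `L h` on the difference of their images. -/
def IsDominated (K : ℕ → Set X) (L : BddMeas Z →L[ℝ] BddMeas Z) (V : Set (X × Z → ℝ))
    (A : (X × Z → ℝ) → X × Z → ℝ) : Prop :=
  MapsTo A V V ∧ ∀ j, ∀ v ∈ V, ∀ w ∈ V, ∀ h : BddMeas Z,
    (∀ x ∈ K j, ∀ z, |v (x, z) - w (x, z)| ≤ h z) →
      ∀ x ∈ K j, ∀ z, |A v (x, z) - A w (x, z)| ≤ L h z

variable {K : ℕ → Set X} {L : BddMeas Z →L[ℝ] BddMeas Z} {V : Set (X × Z → ℝ)}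
  {A : (X × Z → ℝ) → X × Z → ℝ}

/-- The constant function `C`. -/
def BddMeas.const (Z : Type*) [MeasurableSpace Z] (C : ℝ) : BddMeas Z :=
  BddMeas.mk (fun _ => C) measurable_const |C| fun _ => le_rfl

theorem BddMeas.apply_const_le (L : BddMeas Z →L[ℝ] BddMeas Z) {C : ℝ} (hC : 0 ≤ C) (z : Z) :
    L (BddMeas.const Z C) z ≤ ‖L‖ * C := by
  refine (le_abs_self _).trans ((BddMeas.abs_le_norm _ z).trans ((L.le_opNorm _).trans ?_))
  refine mul_le_mul_of_nonneg_left (BddMeas.norm_le_of _ hC fun _ => ?_) (norm_nonneg _)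
  exact (abs_of_nonneg hC).le

/-- Function-valued bounds `h` compose to `L ^ n`. Constant bounds would only give `‖L‖ ^ n`, which
need not tend to zero. -/
theorem IsDominated.iterate (hA : IsDominated K L V A) (n : ℕ) :
    IsDominated K (L ^ n) V A^[n] := by
  induction n with
  | zero => exact ⟨mapsTo_id V, fun j v _ w _ h hh => hh⟩
  | succ n ih =>
    rw [Function.iterate_succ', pow_succ']
    refine ⟨hA.1.comp ih.1, fun j v hv w hw h hh => ?_⟩
    exact hA.2 j _ (ih.1 hv) _ (ih.1 hw) _ (ih.2 j v hv w hw h hh)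

theorem IsDominated.abs_sub_le (hA : IsDominated K L V A) {v w : X × Z → ℝ} (hv : v ∈ V)
    (hw : w ∈ V) {j : ℕ} {C : ℝ} (hC : 0 ≤ C) (h : ∀ x ∈ K j, ∀ z, |v (x, z) - w (x, z)| ≤ C)
    {x : X} (hx : x ∈ K j) (z : Z) : |A v (x, z) - A w (x, z)| ≤ ‖L‖ * C :=
  (hA.2 j v hv w hw (BddMeas.const Z C) h x hx z).trans (BddMeas.apply_const_le L hC z)

theorem tendsto_tsum_norm_pow_add (L : BddMeas Z →L[ℝ] BddMeas Z) :
    Tendsto (fun n => ∑' k, ‖L ^ (n + k)‖) atTop (𝓝 0) := by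
  simpa only [add_comm] using tendsto_sum_nat_add fun n => ‖L ^ n‖

/-- The iterates of a dominated operator converge pointwise, with an explicit rate that is uniform
on every `K j × Z`. -/
theorem IsDominated.exists_limit (hA : IsDominated K L V A) (hL : Summable fun n => ‖L ^ n‖)
    (hK : ⋃ j, K j = univ) {v : X × Z → ℝ} (hv : v ∈ V)
    (hb : ∀ j, ∃ B, ∀ x ∈ K j, ∀ z, |A v (x, z) - v (x, z)| ≤ B) :
    ∃ w : X × Z → ℝ, (∀ s, Tendsto (fun n => A^[n] v s) atTop (𝓝 (w s))) ∧
      ∀ j B, 0 ≤ B → (∀ x ∈ K j, ∀ z, |A v (x, z) - v (x, z)| ≤ B) →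
        ∀ n, ∀ x ∈ K j, ∀ z, |A^[n] v (x, z) - w (x, z)| ≤ (∑' k, ‖L ^ (n + k)‖) * B := by
  -- Consecutive iterates are the images of `v` and `A v` under `A^[n]`.
  have hstep : ∀ j B, 0 ≤ B → (∀ x ∈ K j, ∀ z, |A v (x, z) - v (x, z)| ≤ B) →
      ∀ n, ∀ x ∈ K j, ∀ z, dist (A^[n] v (x, z)) (A^[n + 1] v (x, z)) ≤ ‖L ^ n‖ * B := by
    intro j B hB h n x hx z
    rw [dist_comm, Real.dist_eq, Function.iterate_succ_apply]
    exact (hA.iterate n).abs_sub_le (hA.1 hv) hv hB h hx z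
  have hconv : ∀ s : X × Z, ∃ y, Tendsto (fun n => A^[n] v s) atTop (𝓝 y) := by
    rintro ⟨x, z⟩
    obtain ⟨j, hj⟩ := mem_iUnion.1 (hK ▸ mem_univ x)
    obtain ⟨B, hB⟩ := hb j
    have hB' : ∀ x ∈ K j, ∀ z, |A v (x, z) - v (x, z)| ≤ |B| :=
      fun x hx z => (hB x hx z).trans (le_abs_self B)
    exact cauchySeq_tendsto_of_complete (cauchySeq_of_dist_le_of_summable _
      (fun n => hstep j |B| (abs_nonneg B) hB' n x hj z) (hL.mul_right |B|))
  choose w hw using hconv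
  refine ⟨w, hw, fun j B hB h n x hx z => ?_⟩
  have := dist_le_tsum_of_dist_le_of_tendsto _ (fun n => hstep j B hB h n x hx z)
    (hL.mul_right B) (hw (x, z)) n
  rwa [tsum_mul_right] at this

/-- Iterates from two elements of `V` whose difference is bounded on every `K j × Z` have the same
limits. -/
theorem IsDominated.tendsto_of_tendsto (hA : IsDominated K L V A)
    (hL : Summable fun n => ‖L ^ n‖) (hK : ⋃ j, K j = univ) {v w : X × Z → ℝ} (hv : v ∈ V)
    (hw : w ∈ V) (hb : ∀ j, ∃ B, ∀ x ∈ K j, ∀ z, |v (x, z) - w (x, z)| ≤ B) {s : X × Z} {y : ℝ}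
    (h : Tendsto (fun n => A^[n] v s) atTop (𝓝 y)) :
    Tendsto (fun n => A^[n] w s) atTop (𝓝 y) := by
  obtain ⟨x, z⟩ := s
  obtain ⟨j, hj⟩ := mem_iUnion.1 (hK ▸ mem_univ x)
  obtain ⟨B, hB⟩ := hb j
  have h0 : Tendsto (fun n => A^[n] v (x, z) - A^[n] w (x, z)) atTop (𝓝 0) := by
    refine squeeze_zero_norm (fun n => (hA.iterate n).abs_sub_le hv hw (abs_nonneg B)
      (fun x hx z => (hB x hx z).trans (le_abs_self B)) hj z) ?_
    have := hL.tendsto_atTop_zero.mul_const |B|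
    rwa [zero_mul] at this
  simpa using h.sub h0

end Iteration

/-! ### The local suprema. -/

section LocalNorm

variable {X Z : Type*} {K : ℕ → Set X}

theorem localNorm_nonneg (j : ℕ) (f : X × Z → ℝ) : 0 ≤ localNorm K j f :=
  Real.sSup_nonneg (by rintro _ ⟨s, -, rfl⟩; exact abs_nonneg _)

/-- `0 ≤ B` covers an empty `K j`, where the supremum is `0` by default. -/
theorem localNorm_le {j : ℕ} {f : X × Z → ℝ} {B : ℝ} (hB : 0 ≤ B)
    (h : ∀ x ∈ K j, ∀ z, |f (x, z)| ≤ B) : localNorm K j f ≤ B :=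
  Real.sSup_le (by rintro _ ⟨⟨x, z⟩, ⟨hx, -⟩, rfl⟩; exact h x hx z) hB

theorem abs_le_localNorm [TopologicalSpace X] [TopologicalSpace Z] [CompactSpace Z]
    (hK : ∀ j, IsCompact (K j)) {f : X × Z → ℝ} (hf : Continuous f) {j : ℕ} {x : X}
    (hx : x ∈ K j) (z : Z) : |f (x, z)| ≤ localNorm K j f :=
  le_csSup (((hK j).prod isCompact_univ).bddAbove_image hf.abs.continuousOn)
    ⟨(x, z), ⟨hx, mem_univ z⟩, rfl⟩

end LocalNorm

/-! ### Policy operators on locally bounded functions. -/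

section LocallyBounded

attribute [local instance] BddMeas.seminormedAddCommGroup BddMeas.normedSpace
  BddMeas.monoidEnd

variable {X Z : Type*} [MeasurableSpace X] [MeasurableSpace Z]

/-- The measurable functions that are bounded on every `K j × Z`. -/
def locallyBounded (K : ℕ → Set X) : Set (X × Z → ℝ) :=
  {f | Measurable f ∧ ∀ j, ∃ B, ∀ x ∈ K j, ∀ z, |f (x, z)| ≤ B}

variable {K : ℕ → Set X}

theorem exists_abs_sub_le_of_mem_locallyBounded {v w : X × Z → ℝ} (hv : v ∈ locallyBounded K)
    (hw : w ∈ locallyBounded K) (j : ℕ) :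
    ∃ B, ∀ x ∈ K j, ∀ z, |v (x, z) - w (x, z)| ≤ B := by
  obtain ⟨B, hB⟩ := hv.2 j
  obtain ⟨C, hC⟩ := hw.2 j
  exact ⟨B + C, fun x hx z => (abs_sub _ _).trans (add_le_add (hB x hx z) (hC x hx z))⟩

theorem zero_mem_locallyBounded : (fun _ => 0 : X × Z → ℝ) ∈ locallyBounded K :=
  ⟨measurable_const, fun _ => ⟨0, by simp⟩⟩

theorem integrable_of_mem_locallyBounded {v : X × Z → ℝ} (hv : v ∈ locallyBounded K) {j : ℕ}
    {a : X} (ha : a ∈ K j) (μ : Measure Z) [IsFiniteMeasure μ] :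
    Integrable (fun z => v (a, z)) μ := by
  obtain ⟨B, hB⟩ := hv.2 j
  exact Integrable.of_bound (hv.1.comp measurable_prodMk_left).aestronglyMeasurable B
    (Eventually.of_forall fun z => hB a ha z)

theorem Continuous.mem_locallyBounded [TopologicalSpace X] [TopologicalSpace Z] [CompactSpace Z]
    [OpensMeasurableSpace (X × Z)] (hK : ∀ j, IsCompact (K j)) {f : X × Z → ℝ}
    (hf : Continuous f) : f ∈ locallyBounded K :=
  ⟨hf.measurable, fun j => ⟨localNorm K j f, fun _ hx z => abs_le_localNorm hK hf hx z⟩⟩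

variable (u : (X × Z) × X → ℝ) {β : BddMeas Z} (Q : Kernel Z Z) [IsMarkovKernel Q]

/-- The rewards cancel, and as the action is the next `X`-state and lies in `K j`, the bound `h`
applies under the integral. -/
theorem abs_separableAggregator_sub_le (hβ : ∀ z, 0 ≤ β z) {v w : X × Z → ℝ}
    (hv : v ∈ locallyBounded K) (hw : w ∈ locallyBounded K) {j : ℕ} {h : BddMeas Z}
    (hh : ∀ x ∈ K j, ∀ z, |v (x, z) - w (x, z)| ≤ h z) (s : X × Z) {a : X} (ha : a ∈ K j) :
    |separableAggregator u (fun z => β z) Q s a v - separableAggregator u (fun z => β z) Q s a w|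
      ≤ discountOp Q β h s.2 := by
  rw [discountOp_apply, separableAggregator, separableAggregator, add_sub_add_left_eq_sub,
    ← mul_sub, abs_mul, abs_of_nonneg (hβ s.2),
    ← integral_sub (integrable_of_mem_locallyBounded hv ha _)
      (integrable_of_mem_locallyBounded hw ha _)]
  refine mul_le_mul_of_nonneg_left ?_ (hβ s.2)
  exact norm_integral_le_of_norm_le (f := fun z => v (a, z) - w (a, z)) (h.integrable _)
    (Eventually.of_forall fun z => hh a ha z)

theorem separableAggregator_mono (hβ : ∀ z, 0 ≤ β z) {v w : X × Z → ℝ}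
    (hv : v ∈ locallyBounded K) (hw : w ∈ locallyBounded K) (hvw : v ≤ w) (s : X × Z) {j : ℕ}
    {a : X} (ha : a ∈ K j) :
    separableAggregator u (fun z => β z) Q s a v ≤ separableAggregator u (fun z => β z) Q s a w :=
  add_le_add_right (mul_le_mul_of_nonneg_left
    (integral_mono (integrable_of_mem_locallyBounded hv ha _)
      (integrable_of_mem_locallyBounded hw ha _) fun z => hvw (a, z)) (hβ s.2)) _

variable {Γ : X × Z → Set X} {u}

theorem measurable_policyOp (hu : ∀ σ ∈ feasiblePolicies Γ, Measurable fun s => u (s, σ s))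
    {σ : X × Z → X} (hσ : σ ∈ feasiblePolicies Γ) {v : X × Z → ℝ} (hv : Measurable v) :
    Measurable (policyOp (separableAggregator u (fun z => β z) Q) σ v) := by
  -- Pulling the kernel back to `X × Z` lets the integrand depend on the whole state through `σ s`.
  have h : StronglyMeasurable fun s : X × Z =>
      ∫ z', v (σ s, z') ∂((Q.comap Prod.snd measurable_snd : Kernel (X × Z) Z) s) := by
    refine StronglyMeasurable.integral_kernel_prod_right' (f := fun p => v (σ p.1, p.2)) ?_
    exact (hv.comp ((hσ.1.comp measurable_fst).prodMk measurable_snd)).stronglyMeasurable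
  exact (hu σ hσ).add ((β.measurable.comp measurable_snd).mul h.measurable)

theorem isDominated_policyOp (hβ : ∀ z, 0 ≤ β z)
    (hΓK : ∀ j, ∀ x ∈ K j, ∀ z, Γ (x, z) ⊆ K j)
    (hum : ∀ σ ∈ feasiblePolicies Γ, Measurable fun s => u (s, σ s))
    (hub : ∀ j, ∃ B, ∀ x ∈ K j, ∀ z, ∀ a ∈ Γ (x, z), |u ((x, z), a)| ≤ B)
    {σ : X × Z → X} (hσ : σ ∈ feasiblePolicies Γ) :
    IsDominated K (discountOp Q β) (locallyBounded K)
      (policyOp (separableAggregator u (fun z => β z) Q) σ) := by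
  have hdom : ∀ j, ∀ v ∈ locallyBounded K, ∀ w ∈ locallyBounded K, ∀ h : BddMeas Z,
      (∀ x ∈ K j, ∀ z, |v (x, z) - w (x, z)| ≤ h z) → ∀ x ∈ K j, ∀ z,
        |policyOp (separableAggregator u (fun z => β z) Q) σ v (x, z)
          - policyOp (separableAggregator u (fun z => β z) Q) σ w (x, z)|
          ≤ discountOp Q β h z :=
    fun j v hv w hw h hh x hx z =>
      abs_separableAggregator_sub_le u Q hβ hv hw hh (x, z) (hΓK j x hx z (hσ.2 _))
  refine ⟨fun v hv => ⟨measurable_policyOp Q hum hσ hv.1, fun j => ?_⟩, hdom⟩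
  obtain ⟨B, hB⟩ := hv.2 j
  obtain ⟨C, hC⟩ := hub j
  refine ⟨‖discountOp Q β (BddMeas.const Z B)‖ + C, fun x hx z => ?_⟩
  -- Comparison with `T_σ 0`, which is the reward, bounds `T_σ v` on `K j × Z`.
  have h1 := hdom j v hv _ zero_mem_locallyBounded (BddMeas.const Z B)
    (fun x hx z => by rw [sub_zero]; exact hB x hx z) x hx z
  have h2 : policyOp (separableAggregator u (fun z => β z) Q) σ (fun _ => 0) (x, z)
      = u ((x, z), σ (x, z)) := by
    simp [policyOp, separableAggregator]
  rw [h2] at h1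
  have h3 := (le_abs_self _).trans (BddMeas.abs_le_norm (discountOp Q β (BddMeas.const Z B)) z)
  have h4 := hC x hx z _ (hσ.2 _)
  have h5 := abs_sub_abs_le_abs_sub
    (policyOp (separableAggregator u (fun z => β z) Q) σ v (x, z)) (u ((x, z), σ (x, z)))
  linarith

end LocallyBounded

/-! ### Expectations under a Feller kernel. -/

section Feller

variable {X Z : Type*} [TopologicalSpace X] [TopologicalSpace Z] [CompactSpace Z]
  [MeasurableSpace Z] [OpensMeasurableSpace Z]

/-- Joint continuity of the expectation of a continuous function under a Feller kernel. -/
theorem IsFeller.continuous_integral {Q : Kernel Z Z} [IsMarkovKernel Q] (hQ : IsFeller Q)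
    {v : X × Z → ℝ} (hv : Continuous v) :
    Continuous fun p : X × Z => ∫ z', v (p.1, z') ∂(Q p.2) := by
  -- As `Z` is compact, `x ↦ v(x, ·)` is continuous in the sup norm. Moving `x` thus costs little
  -- uniformly over the measures `Q z`, and the Feller property handles `z`.
  let V : X → C(Z, ℝ) := ContinuousMap.curry ⟨v, hv⟩
  have hV : Continuous V := (ContinuousMap.curry ⟨v, hv⟩).continuous
  have hint : ∀ (f : C(Z, ℝ)) z, Integrable (fun z' => f z') (Q z) := fun f z =>
    Integrable.of_bound f.continuous.measurable.aestronglyMeasurable ‖f‖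
      (Eventually.of_forall f.norm_coe_le_norm)
  refine continuous_iff_continuousAt.2 fun p₀ => ?_
  have h1 : Tendsto (fun p : X × Z => ∫ z', V p₀.1 z' ∂(Q p.2)) (𝓝 p₀)
      (𝓝 (∫ z', V p₀.1 z' ∂(Q p₀.2))) :=
    ((hQ (BoundedContinuousFunction.mkOfCompact (V p₀.1))).comp continuous_snd).continuousAt
  have h2 : Tendsto (fun p : X × Z => ∫ z', V p.1 z' ∂(Q p.2) - ∫ z', V p₀.1 z' ∂(Q p.2)) (𝓝 p₀)
      (𝓝 0) := by
    have h3 : Tendsto (fun p : X × Z => ‖V p.1 - V p₀.1‖) (𝓝 p₀) (𝓝 0) := by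
      have : Continuous fun p : X × Z => ‖V p.1 - V p₀.1‖ :=
        ((hV.comp continuous_fst).sub continuous_const).norm
      simpa using this.tendsto p₀
    refine squeeze_zero_norm (fun p => ?_) h3
    rw [← integral_sub (hint _ _) (hint _ _)]
    have := norm_integral_le_of_norm_le_const (μ := Q p.2) (C := ‖V p.1 - V p₀.1‖)
      (Eventually.of_forall (V p.1 - V p₀.1).norm_coe_le_norm)
    simpa using this
  have := h2.add h1
  simp only [sub_add_cancel, zero_add] at this
  exact this

end Feller

/-! ### Continuity, measurability and bounds for the reward. -/

section Reward

variable {X Z : Type*} [MetricSpace X] [MetricSpace Z] {K : ℕ → Set X} {Γ : X × Z → Set X}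
  {u : (X × Z) × X → ℝ}

theorem continuousOn_separableAggregator [CompactSpace Z] [MeasurableSpace Z] [BorelSpace Z]
    {β : BddMeas Z} {Q : Kernel Z Z} [IsMarkovKernel Q] (hu : ContinuousOn u (feasibleGraph Γ))
    (hβ : Continuous fun z => β z) (hQ : IsFeller Q) {v : X × Z → ℝ} (hv : Continuous v) :
    ContinuousOn (fun p : (X × Z) × X => separableAggregator u (fun z => β z) Q p.1 p.2 v)
      (feasibleGraph Γ) := by
  refine hu.add (Continuous.continuousOn ?_)
  have h := (hQ.continuous_integral hv).comp
    (continuous_snd.prodMk (continuous_snd.comp continuous_fst) :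
      Continuous fun p : (X × Z) × X => (p.2, p.1.2))
  exact (hβ.comp (continuous_snd.comp continuous_fst)).mul h

/-- `u` is continuous only on the graph, so the composition is factored through that subtype. -/
theorem measurable_reward [MeasurableSpace X] [MeasurableSpace Z] [BorelSpace X] [BorelSpace Z]
    [SecondCountableTopology X] [SecondCountableTopology Z] (hu : ContinuousOn u (feasibleGraph Γ))
    {σ : X × Z → X} (hσ : σ ∈ feasiblePolicies Γ) : Measurable fun s => u (s, σ s) := by
  have h : Measurable fun s => (⟨(s, σ s), hσ.2 s⟩ : feasibleGraph Γ) :=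
    (measurable_id.prodMk hσ.1).subtype_mk
  exact (continuousOn_iff_continuous_domRestrict.1 hu).measurable.comp h

/-- The part of the graph of `Γ` over `C × Z` with actions in `C` is compact. -/
theorem isCompact_feasibleGraph_inter [CompactSpace Z] (huhc : UpperHemicontinuous Γ)
    (hc : ∀ s, IsCompact (Γ s)) {C : Set X} (hC : IsCompact C) :
    IsCompact (feasibleGraph Γ ∩ (C ×ˢ univ) ×ˢ C) :=
  ((hC.prod isCompact_univ).prod hC).inter_left
    (isClosed_feasibleGraph huhc fun s => (hc s).isClosed)

theorem exists_reward_bound [CompactSpace Z] (huhc : UpperHemicontinuous Γ)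
    (hc : ∀ s, IsCompact (Γ s)) (hK : ∀ j, IsCompact (K j))
    (hΓK : ∀ j, ∀ x ∈ K j, ∀ z, Γ (x, z) ⊆ K j) (hu : ContinuousOn u (feasibleGraph Γ)) (j : ℕ) :
    ∃ B, ∀ x ∈ K j, ∀ z, ∀ a ∈ Γ (x, z), |u ((x, z), a)| ≤ B := by
  obtain ⟨B, hB⟩ := (isCompact_feasibleGraph_inter huhc hc (hK j)).exists_bound_of_continuousOn
    (hu.mono inter_subset_left)
  exact ⟨B, fun x hx z a ha => hB ((x, z), a) ⟨ha, ⟨hx, mem_univ z⟩, hΓK j x hx z ha⟩⟩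

end Reward

/-! ### Fixed point, greedy policies and optimality. -/

section Program

attribute [local instance] BddMeas.seminormedAddCommGroup BddMeas.normedSpace
  BddMeas.monoidEnd

/-- The standing assumptions on the exhaustion and on the primitives of the dynamic program. -/
structure IsFellerProgram {X Z : Type*} [MetricSpace X] [MetricSpace Z] [MeasurableSpace Z]
    (K : ℕ → Set X) (Γ : X × Z → Set X) (u : (X × Z) × X → ℝ) (β : BddMeas Z) (Q : Kernel Z Z)
    [IsMarkovKernel Q] : Prop where
  isCompact_exhaustion : ∀ j, IsCompact (K j)
  iUnion_interior : ⋃ j, interior (K j) = univ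
  upperHemicontinuous : UpperHemicontinuous Γ
  lowerHemicontinuous : LowerHemicontinuous Γ
  nonempty : ∀ s, (Γ s).Nonempty
  isCompact : ∀ s, IsCompact (Γ s)
  discount_nonneg : ∀ z, 0 ≤ β z
  continuous_discount : Continuous fun z => β z
  continuousOn_reward : ContinuousOn u (feasibleGraph Γ)
  isFeller : IsFeller Q
  subset_exhaustion : ∀ j, ∀ x ∈ K j, ∀ z, Γ (x, z) ⊆ K j
  summable_norm_pow : Summable fun n => ‖discountOp Q β ^ n‖

namespace IsFellerProgram

variable {X Z : Type*} [MetricSpace X] [MetricSpace Z] [MeasurableSpace Z]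
  {K : ℕ → Set X} {Γ : X × Z → Set X}
  {u : (X × Z) × X → ℝ} {β : BddMeas Z} {Q : Kernel Z Z} [IsMarkovKernel Q]

theorem iUnion_exhaustion (h : IsFellerProgram K Γ u β Q) : ⋃ j, K j = univ :=
  univ_subset_iff.1 (h.iUnion_interior ▸ iUnion_mono fun _ => interior_subset)

theorem secondCountableTopology (h : IsFellerProgram K Γ u β Q) : SecondCountableTopology X :=
  have : SigmaCompactSpace X :=
    ⟨⟨K, h.isCompact_exhaustion, h.iUnion_exhaustion⟩⟩
  inferInstance

theorem policyOp_monotoneOn [MeasurableSpace X] (h : IsFellerProgram K Γ u β Q) {σ : X × Z → X}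
    (hσ : σ ∈ feasiblePolicies Γ) :
    MonotoneOn (policyOp (separableAggregator u (fun z => β z) Q) σ) (locallyBounded K) := by
  rintro v hv w hw hvw ⟨x, z⟩
  obtain ⟨j, hj⟩ := mem_iUnion.1 (h.iUnion_exhaustion ▸ mem_univ x)
  exact separableAggregator_mono u Q h.discount_nonneg hv hw hvw (x, z)
    (h.subset_exhaustion j x hj z (hσ.2 _))

variable [CompactSpace Z] [BorelSpace Z]

theorem isGreatest_bellmanOp (h : IsFellerProgram K Γ u β Q) {v : X × Z → ℝ} (hv : Continuous v)
    (s : X × Z) :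
    IsGreatest ((fun a => separableAggregator u (fun z => β z) Q s a v) '' Γ s)
      (bellmanOp (separableAggregator u (fun z => β z) Q) Γ v s) :=
  isGreatest_sSup_image_of_isCompact (h.isCompact s) (h.nonempty s)
    ((continuousOn_separableAggregator h.continuousOn_reward h.continuous_discount h.isFeller
      hv).feasibleGraph_section s)

theorem continuous_bellmanOp (h : IsFellerProgram K Γ u β Q) {v : X × Z → ℝ}
    (hv : Continuous v) :
    Continuous (bellmanOp (separableAggregator u (fun z => β z) Q) Γ v) :=
  continuous_sSup_image_of_hemicontinuous h.upperHemicontinuous h.lowerHemicontinuous h.nonempty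
    h.isCompact
    (continuousOn_separableAggregator h.continuousOn_reward h.continuous_discount h.isFeller hv)

variable [MeasurableSpace X] [BorelSpace X]

theorem opensMeasurableSpace (h : IsFellerProgram K Γ u β Q) : OpensMeasurableSpace (X × Z) :=
  have := h.secondCountableTopology
  inferInstance

theorem mem_locallyBounded (h : IsFellerProgram K Γ u β Q) {v : X × Z → ℝ} (hv : Continuous v) :
    v ∈ locallyBounded K :=
  have := h.opensMeasurableSpace
  hv.mem_locallyBounded h.isCompact_exhaustion

theorem isDominated_policyOp (h : IsFellerProgram K Γ u β Q) {σ : X × Z → X}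
    (hσ : σ ∈ feasiblePolicies Γ) :
    IsDominated K (discountOp Q β) (locallyBounded K)
      (policyOp (separableAggregator u (fun z => β z) Q) σ) :=
  have := h.secondCountableTopology
  _root_.isDominated_policyOp Q h.discount_nonneg h.subset_exhaustion
    (fun _ hσ => measurable_reward h.continuousOn_reward hσ)
    (exists_reward_bound h.upperHemicontinuous h.isCompact h.isCompact_exhaustion
      h.subset_exhaustion h.continuousOn_reward) hσ

/-- A maximizer for `v` is feasible for `w`, so `T v ≤ T w + L_β b`; exchanging `v` and `w` gives
the other side. -/
theorem isDominated_bellmanOp (h : IsFellerProgram K Γ u β Q) :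
    IsDominated K (discountOp Q β) {v | Continuous v}
      (bellmanOp (separableAggregator u (fun z => β z) Q) Γ) := by
  refine ⟨fun v hv => h.continuous_bellmanOp hv, fun j v hv w hw b hb x hx z => ?_⟩
  have key : ∀ v w : X × Z → ℝ, Continuous v → Continuous w →
      (∀ x ∈ K j, ∀ z, |v (x, z) - w (x, z)| ≤ b z) →
      bellmanOp (separableAggregator u (fun z => β z) Q) Γ v (x, z)
        ≤ bellmanOp (separableAggregator u (fun z => β z) Q) Γ w (x, z)
          + discountOp Q β b z := by
    intro v w hv hw hb
    obtain ⟨a, ha, heq⟩ := (h.isGreatest_bellmanOp hv (x, z)).1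
    have h1 := abs_separableAggregator_sub_le u Q h.discount_nonneg (h.mem_locallyBounded hv)
      (h.mem_locallyBounded hw) hb (x, z) (h.subset_exhaustion j x hx z ha)
    have h2 := (h.isGreatest_bellmanOp hw (x, z)).2 ⟨a, ha, rfl⟩
    rw [← heq]
    have h3 := (abs_le.1 h1).2
    simp only at h2 h3 ⊢
    linarith
  have h1 := key v w hv hw hb
  have h2 := key w v hw hv fun x hx z => by rw [abs_sub_comm]; exact hb x hx z
  exact abs_le.2 ⟨by linarith, by linarith⟩

/-- The lifetime value of a policy exists and does not depend on the locally bounded initial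
condition. -/
theorem exists_policyValue (h : IsFellerProgram K Γ u β Q) {σ : X × Z → X}
    (hσ : σ ∈ feasiblePolicies Γ) :
    ∃ w, IsPolicyValue (separableAggregator u (fun z => β z) Q) (locallyBounded K) σ w := by
  have hA := h.isDominated_policyOp hσ
  have h0 : (fun _ => 0 : X × Z → ℝ) ∈ locallyBounded K := zero_mem_locallyBounded
  obtain ⟨w, hw, -⟩ := hA.exists_limit h.summable_norm_pow h.iUnion_exhaustion h0
    (exists_abs_sub_le_of_mem_locallyBounded (hA.1 h0) h0)
  exact ⟨w, fun v hv s => hA.tendsto_of_tendsto h.summable_norm_pow h.iUnion_exhaustion h0 hv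
    (exists_abs_sub_le_of_mem_locallyBounded h0 hv) (hw s)⟩

/-- The Bellman operator has a continuous fixed point, with a local bound in terms of `T 0`. -/
theorem exists_fixedPoint (h : IsFellerProgram K Γ u β Q) :
    ∃ w : X × Z → ℝ, Continuous w ∧
      bellmanOp (separableAggregator u (fun z => β z) Q) Γ w = w ∧
      ∃ C, ∀ j, localNorm K j w ≤
        C * localNorm K j (bellmanOp (separableAggregator u (fun z => β z) Q) Γ fun _ => 0) := by
  have hA := h.isDominated_bellmanOp
  have h0 : (fun _ => 0 : X × Z → ℝ) ∈ {v : X × Z → ℝ | Continuous v} := continuous_const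
  set T := bellmanOp (separableAggregator u (fun z => β z) Q) Γ with hT
  have hb : ∀ j, ∀ x ∈ K j, ∀ z, |T (fun _ => 0) (x, z) - 0| ≤ localNorm K j (T fun _ => 0) :=
    fun j x hx z => by
      rw [sub_zero]; exact abs_le_localNorm h.isCompact_exhaustion (hA.1 h0) hx z
  obtain ⟨w, hw, hrate⟩ := hA.exists_limit h.summable_norm_pow h.iUnion_exhaustion h0
    fun j => ⟨_, hb j⟩
  have hrate' := fun j => hrate j _ (localNorm_nonneg j _) (hb j)
  have htail : ∀ j, Tendsto (fun n => (∑' k, ‖discountOp Q β ^ (n + k)‖)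
      * localNorm K j (T fun _ => 0)) atTop (𝓝 0) := fun j => by
    have := (tendsto_tsum_norm_pow_add (discountOp Q β)).mul_const (localNorm K j (T fun _ => 0))
    rwa [zero_mul] at this
  have hcont : Continuous w := by
    refine continuous_iff_continuousAt.2 fun s => ?_
    -- With `s.1` interior to `K j`, uniform convergence on `K j × Z` gives continuity at `s`.
    obtain ⟨j, hj⟩ := mem_iUnion.1 (h.iUnion_interior ▸ mem_univ s.1)
    have hunif : TendstoUniformlyOn (fun n => T^[n] fun _ => 0) w atTop (K j ×ˢ univ) := by
      refine Metric.tendstoUniformlyOn_iff.2 fun ε hε => ?_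
      filter_upwards [(htail j).eventually_lt_const hε] with n hn
      rintro ⟨x, z⟩ ⟨hx, -⟩
      rw [dist_comm, Real.dist_eq]
      exact (hrate' j n x hx z).trans_lt hn
    refine (hunif.continuousOn (Eventually.frequently (Eventually.of_forall fun n =>
      ((hA.iterate n).1 h0 : Continuous _).continuousOn))).continuousAt ?_
    exact prod_mem_nhds (mem_interior_iff_mem_nhds.1 hj) univ_mem
  -- The constant is the rate at `n = 0`, where the iterate is still `0` and the error is `|w|`.
  refine ⟨w, hcont, ?_, ∑' k, ‖discountOp Q β ^ (0 + k)‖, fun j => ?_⟩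
  · funext s
    obtain ⟨x, z⟩ := s
    obtain ⟨j, hj⟩ := mem_iUnion.1 (h.iUnion_exhaustion ▸ mem_univ x)
    have h1 : Tendsto (fun n => T (T^[n] fun _ => 0) (x, z) - T w (x, z)) atTop (𝓝 0) := by
      refine squeeze_zero_norm (fun n => hA.abs_sub_le ((hA.iterate n).1 h0) hcont
        (mul_nonneg (tsum_nonneg fun _ => norm_nonneg _) (localNorm_nonneg _ _))
        (hrate' j n) hj z) ?_
      have := (htail j).const_mul ‖discountOp Q β‖
      rwa [mul_zero] at this
    have h2 : Tendsto (fun n => T (T^[n] fun _ => 0) (x, z)) atTop (𝓝 (w (x, z))) := by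
      simpa only [Function.comp_def, Function.iterate_succ_apply'] using
        (hw (x, z)).comp (tendsto_add_atTop_nat 1)
    have h3 := h1.add_const (T w (x, z))
    simp only [sub_add_cancel, zero_add] at h3
    exact tendsto_nhds_unique h3 h2
  · refine localNorm_le (mul_nonneg (tsum_nonneg fun _ => norm_nonneg _) (localNorm_nonneg _ _))
      fun x hx z => ?_
    have := hrate' j 0 x hx z
    rwa [Function.iterate_zero, id, zero_sub, abs_neg] at this

/-- A policy attaining the maximum in the Bellman equation exists. -/
theorem exists_greedy (h : IsFellerProgram K Γ u β Q) {v : X × Z → ℝ} (hv : Continuous v) :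
    ∃ σ ∈ feasiblePolicies Γ, policyOp (separableAggregator u (fun z => β z) Q) σ v
      = bellmanOp (separableAggregator u (fun z => β z) Q) Γ v := by
  have := h.secondCountableTopology
  set T := bellmanOp (separableAggregator u (fun z => β z) Q) Γ
  set H := fun p : (X × Z) × X => separableAggregator u (fun z => β z) Q p.1 p.2 v
  have hH : ContinuousOn H (feasibleGraph Γ) := continuousOn_separableAggregator
    h.continuousOn_reward h.continuous_discount h.isFeller hv
  have hTv : Continuous (T v) := h.continuous_bellmanOp hv
  have hgraph : IsClosed (feasibleGraph Γ) :=
    isClosed_feasibleGraph h.upperHemicontinuous fun s => (h.isCompact s).isClosed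
  let M : Set ((X × Z) × X) := feasibleGraph Γ ∩ {p | H p - T v p.1 = 0}
  have hM : IsClosed M :=
    (hH.sub (hTv.comp continuous_fst).continuousOn).preimage_isClosed_of_isClosed hgraph
      isClosed_singleton
  let G : X × Z → Set X := fun s => {a | (s, a) ∈ M}
  have hGc : ∀ s, IsCompact (G s) := fun s =>
    (h.isCompact s).of_isClosed_subset (hM.preimage (Continuous.prodMk_right s)) fun a ha => ha.1
  have hGn : ∀ s, (G s).Nonempty := fun s => by
    obtain ⟨a, ha, heq⟩ := (h.isGreatest_bellmanOp hv s).1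
    exact ⟨a, ha, sub_eq_zero.2 heq⟩
  have hGm : ∀ F, IsClosed F → MeasurableSet {s | (G s ∩ F).Nonempty} := by
    intro F hF
    -- A countable union of projections of compact sets, because actions over `K j` stay in `K j`.
    have heq : {s | (G s ∩ F).Nonempty} = ⋃ j, Prod.fst ''
        ((feasibleGraph Γ ∩ (K j ×ˢ univ) ×ˢ K j) ∩ (M ∩ Prod.snd ⁻¹' F)) := by
      ext s
      rw [mem_iUnion]
      constructor
      · rintro ⟨a, haG, haF⟩
        obtain ⟨j, hj⟩ := mem_iUnion.1 (h.iUnion_exhaustion ▸ mem_univ s.1)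
        exact ⟨j, (s, a), ⟨⟨haG.1, ⟨hj, mem_univ _⟩, h.subset_exhaustion j s.1 hj s.2 haG.1⟩,
          haG, haF⟩, rfl⟩
      · rintro ⟨j, ⟨s, a⟩, ⟨-, haM, haF⟩, rfl⟩
        exact ⟨a, haM, haF⟩
    rw [heq]
    refine MeasurableSet.iUnion fun j => IsClosed.measurableSet (IsCompact.isClosed ?_)
    exact ((isCompact_feasibleGraph_inter h.upperHemicontinuous h.isCompact
      (h.isCompact_exhaustion j)).inter_right
        (hM.inter (hF.preimage continuous_snd))).image continuous_fst
  obtain ⟨σ, hσ, hsel⟩ := exists_measurable_selection hGc hGn hGm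
  exact ⟨σ, ⟨hσ, fun s => (hsel s).1⟩, funext fun s => sub_eq_zero.1 (hsel s).2⟩

/-- A policy value lies below `T_σ w` for every continuous fixed point `w` of the Bellman
operator. -/
theorem policyValue_le (h : IsFellerProgram K Γ u β Q) {w : X × Z → ℝ} (hw : Continuous w)
    (hfix : bellmanOp (separableAggregator u (fun z => β z) Q) Γ w = w) {σ : X × Z → X}
    (hσ : σ ∈ feasiblePolicies Γ) {y : X × Z → ℝ}
    (hy : IsPolicyValue (separableAggregator u (fun z => β z) Q) (locallyBounded K) σ y) :
    policyOp (separableAggregator u (fun z => β z) Q) σ w ≤ w ∧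
      y ≤ policyOp (separableAggregator u (fun z => β z) Q) σ w := by
  have hwb := h.mem_locallyBounded hw
  have hA := h.isDominated_policyOp hσ
  have h1 : policyOp (separableAggregator u (fun z => β z) Q) σ w ≤ w := fun s =>
    ((h.isGreatest_bellmanOp hw s).2 ⟨σ s, hσ.2 s, rfl⟩).trans_eq (congrFun hfix s)
  have h2 : ∀ n, (policyOp (separableAggregator u (fun z => β z) Q) σ)^[n] w ≤ w := by
    intro n
    induction n with
    | zero => exact le_rfl
    | succ n ih =>
      rw [Function.iterate_succ_apply']
      exact (h.policyOp_monotoneOn hσ ((hA.iterate n).1 hwb) hwb ih).trans h1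
  -- The shift by one gives `y ≤ T_σ w` rather than just `y ≤ w`; this forces optimal policies to be
  -- greedy.
  refine ⟨h1, fun s => le_of_tendsto ((hy w hwb s).comp (tendsto_add_atTop_nat 1))
    (Eventually.of_forall fun n => ?_)⟩
  simp only [Function.comp_apply, Function.iterate_succ_apply']
  exact h.policyOp_monotoneOn hσ ((hA.iterate n).1 hwb) hwb (h2 n) s

/-- A policy is optimal if and only if it is greedy for the fixed point of the Bellman operator. -/
theorem policyValue_eq_iff (h : IsFellerProgram K Γ u β Q) {w : X × Z → ℝ} (hw : Continuous w)
    (hfix : bellmanOp (separableAggregator u (fun z => β z) Q) Γ w = w) {σ : X × Z → X}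
    (hσ : σ ∈ feasiblePolicies Γ) {y : X × Z → ℝ}
    (hy : IsPolicyValue (separableAggregator u (fun z => β z) Q) (locallyBounded K) σ y) :
    y = w ↔ policyOp (separableAggregator u (fun z => β z) Q) σ w = w := by
  obtain ⟨h1, h2⟩ := h.policyValue_le hw hfix hσ hy
  constructor
  · rintro rfl
    exact le_antisymm h1 h2
  · intro heq
    funext s
    have h3 := hy w (h.mem_locallyBounded hw) s
    simp only [Function.iterate_fixed heq] at h3
    exact tendsto_nhds_unique h3 tendsto_const_nhds

end IsFellerProgram

end Program

/-! ### The weighted spaces. -/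

section WeightedSpace

variable {X Z : Type*} {K : ℕ → Set X}

theorem weight_pos {c : ℝ} (hc : 1 < c) {m : ℕ → ℝ} (hm : IsWeightSeq m) (j : ℕ) :
    0 < m j * c ^ (j + 1) :=
  mul_pos (hm.1 j) (pow_pos (zero_lt_one.trans hc) _)

theorem weighted_localNorm_nonneg {c : ℝ} (hc : 1 < c) {m : ℕ → ℝ} (hm : IsWeightSeq m) (j : ℕ)
    (f : X × Z → ℝ) : 0 ≤ localNorm K j f / (m j * c ^ (j + 1)) :=
  div_nonneg (localNorm_nonneg j f) (weight_pos hc hm j).le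

variable [TopologicalSpace X] [TopologicalSpace Z]

theorem mem_weightedSpace_of_localNorm_le {c : ℝ} (hc : 1 < c) {m : ℕ → ℝ} (hm : IsWeightSeq m)
    {f g : X × Z → ℝ} (hf : Continuous f) {C : ℝ} (hg : g ∈ weightedSpace K c m)
    (h : ∀ j, localNorm K j f ≤ C * localNorm K j g) : f ∈ weightedSpace K c m := by
  refine ⟨hf, Summable.of_nonneg_of_le (weighted_localNorm_nonneg hc hm · f) (fun j => ?_)
    (hg.2.mul_left C)⟩
  rw [← mul_div_assoc]
  exact div_le_div_of_nonneg_right (h j) (weight_pos hc hm j).le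

theorem add_mem_weightedSpace [CompactSpace Z] (hK : ∀ j, IsCompact (K j)) {c : ℝ} (hc : 1 < c)
    {m : ℕ → ℝ} (hm : IsWeightSeq m) {f g : X × Z → ℝ} (hf : f ∈ weightedSpace K c m)
    (hg : g ∈ weightedSpace K c m) : f + g ∈ weightedSpace K c m := by
  refine ⟨hf.1.add hg.1, Summable.of_nonneg_of_le (weighted_localNorm_nonneg hc hm · _)
    (fun j => ?_) (hf.2.add hg.2)⟩
  rw [← add_div]
  refine div_le_div_of_nonneg_right ?_ (weight_pos hc hm j).le
  exact localNorm_le (add_nonneg (localNorm_nonneg j f) (localNorm_nonneg j g)) fun x hx z =>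
    (abs_add_le _ _).trans
      (add_le_add (abs_le_localNorm hK hf.1 hx z) (abs_le_localNorm hK hg.1 hx z))

theorem sub_mem_weightedSpace [CompactSpace Z] (hK : ∀ j, IsCompact (K j)) {c : ℝ} (hc : 1 < c)
    {m : ℕ → ℝ} (hm : IsWeightSeq m) {f g : X × Z → ℝ} (hf : f ∈ weightedSpace K c m)
    (hg : g ∈ weightedSpace K c m) : f - g ∈ weightedSpace K c m := by
  have hneg : -g ∈ weightedSpace K c m :=
    ⟨hg.1.neg, by simpa only [localNorm, Pi.neg_apply, abs_neg] using hg.2⟩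
  exact sub_eq_add_neg f g ▸ add_mem_weightedSpace hK hc hm hf hneg

/-- Every continuous function lies in some weighted space. -/
theorem exists_mem_weightedSpace [CompactSpace Z] (hK : ∀ j, IsCompact (K j)) (hK_mono : Monotone K)
    {c : ℝ} (hc : 1 < c) {f : X × Z → ℝ} (hf : Continuous f) :
    ∃ m, IsWeightSeq m ∧ f ∈ weightedSpace K c m := by
  have hmono : Monotone fun j => localNorm K j f := fun i j hij =>
    localNorm_le (localNorm_nonneg j f) fun x hx z => abs_le_localNorm hK hf (hK_mono hij hx) z
  -- The local norm keeps each ratio below one, leaving a geometric series; `j + 1` makes the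
  -- weights positive, strictly increasing and unbounded.
  have hm : IsWeightSeq fun j => localNorm K j f + (j + 1) := by
    refine ⟨fun j => add_pos_of_nonneg_of_pos (localNorm_nonneg j f) j.cast_add_one_pos,
      hmono.add_strictMono fun i j hij => by simpa using hij, ?_⟩
    refine tendsto_atTop_mono (fun j => ?_) tendsto_natCast_atTop_atTop
    have := localNorm_nonneg (K := K) j f
    linarith
  refine ⟨_, hm, hf, Summable.of_nonneg_of_le (weighted_localNorm_nonneg hc hm · f) (fun j => ?_)
    ((summable_nat_add_iff 1).2
      (summable_geometric_of_lt_one (inv_nonneg.2 (zero_le_one.trans hc.le))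
        (inv_lt_one_of_one_lt₀ hc)))⟩
  rw [← div_div, inv_pow, ← one_div]
  refine div_le_div_of_nonneg_right ?_ (pow_pos (zero_lt_one.trans hc) _).le
  refine (div_le_one (hm.1 j)).2 ?_
  have : (0 : ℝ) < j + 1 := j.cast_add_one_pos
  linarith

end WeightedSpace

/-! ### The Bellman operator on the weighted spaces. -/

section Program

attribute [local instance] BddMeas.seminormedAddCommGroup BddMeas.normedSpace
  BddMeas.monoidEnd

namespace IsFellerProgram

variable {X Z : Type*} [MetricSpace X] [MetricSpace Z] [CompactSpace Z] [MeasurableSpace X]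
  [MeasurableSpace Z] [BorelSpace X] [BorelSpace Z]
  {K : ℕ → Set X} {Γ : X × Z → Set X} {u : (X × Z) × X → ℝ} {β : BddMeas Z} {Q : Kernel Z Z}
  [IsMarkovKernel Q]

/-- The factor `‖L_β ^ n‖` does not depend on `j`, so it comes out of the weighted sum. -/
theorem localNorm_iterate_sub_le (h : IsFellerProgram K Γ u β Q) {v w : X × Z → ℝ}
    (hv : Continuous v) (hw : Continuous w) (n j : ℕ) :
    localNorm K j ((bellmanOp (separableAggregator u (fun z => β z) Q) Γ)^[n] v
        - (bellmanOp (separableAggregator u (fun z => β z) Q) Γ)^[n] w)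
      ≤ ‖discountOp Q β ^ n‖ * localNorm K j (v - w) :=
  localNorm_le (mul_nonneg (norm_nonneg _) (localNorm_nonneg _ _)) fun _ hx z =>
    (h.isDominated_bellmanOp.iterate n).abs_sub_le hv hw (localNorm_nonneg _ _)
      (fun _ hx z => abs_le_localNorm h.isCompact_exhaustion (hv.sub hw) hx z) hx z

/-- The Bellman operator preserves every weighted space that contains `T 0`. -/
theorem mapsTo_bellmanOp (h : IsFellerProgram K Γ u β Q) {c : ℝ} (hc : 1 < c) {m : ℕ → ℝ}
    (hm : IsWeightSeq m)
    (h0 : bellmanOp (separableAggregator u (fun z => β z) Q) Γ (fun _ => 0)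
      ∈ weightedSpace K c m) :
    MapsTo (bellmanOp (separableAggregator u (fun z => β z) Q) Γ) (weightedSpace K c m)
      (weightedSpace K c m) := by
  intro v hv
  -- `T v = (T v - T 0) + T 0`, where the difference is dominated by `v`.
  rw [← sub_add_cancel (bellmanOp (separableAggregator u (fun z => β z) Q) Γ v)
    (bellmanOp (separableAggregator u (fun z => β z) Q) Γ fun _ => 0)]
  refine add_mem_weightedSpace h.isCompact_exhaustion hc hm ?_ h0
  refine mem_weightedSpace_of_localNorm_le (C := ‖discountOp Q β ^ 1‖) hc hm
    ((h.continuous_bellmanOp hv.1).sub h0.1) hv fun j => ?_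
  have := h.localNorm_iterate_sub_le hv.1 (continuous_const (y := (0 : ℝ))) 1 j
  rwa [show v - (fun _ => 0) = v from sub_zero v] at this

/-- Value iteration converges to any fixed point of the Bellman operator. -/
theorem tendsto_weightedNorm_iterate (h : IsFellerProgram K Γ u β Q) {c : ℝ} (hc : 1 < c)
    {m : ℕ → ℝ} (hm : IsWeightSeq m) {v w : X × Z → ℝ} (hv : v ∈ weightedSpace K c m)
    (hw : w ∈ weightedSpace K c m)
    (hfix : bellmanOp (separableAggregator u (fun z => β z) Q) Γ w = w) :
    Tendsto (fun n : ℕ => weightedNorm K c m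
      ((bellmanOp (separableAggregator u (fun z => β z) Q) Γ)^[n] v - w)) atTop (𝓝 0) := by
  have hlim := h.summable_norm_pow.tendsto_atTop_zero.mul_const (weightedNorm K c m (v - w))
  rw [zero_mul] at hlim
  refine squeeze_zero (fun n => tsum_nonneg fun j => weighted_localNorm_nonneg hc hm j _)
    (fun n => ?_) hlim
  have hsum := (sub_mem_weightedSpace h.isCompact_exhaustion hc hm hv hw).2
  have hle : ∀ j, localNorm K j ((bellmanOp (separableAggregator u (fun z => β z) Q) Γ)^[n] v - w)
      / (m j * c ^ (j + 1))
      ≤ ‖discountOp Q β ^ n‖ * (localNorm K j (v - w) / (m j * c ^ (j + 1))) := fun j => by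
    rw [← mul_div_assoc]
    have := h.localNorm_iterate_sub_le hv.1 hw.1 n j
    rw [Function.iterate_fixed hfix] at this
    exact div_le_div_of_nonneg_right this (weight_pos hc hm j).le
  rw [weightedNorm, weightedNorm, ← tsum_mul_left]
  exact Summable.tsum_le_tsum hle (Summable.of_nonneg_of_le
    (weighted_localNorm_nonneg hc hm · _) hle (hsum.mul_left _)) (hsum.mul_left _)

/-- The Bellman operator has at most one continuous fixed point. -/
theorem fixedPoint_unique (h : IsFellerProgram K Γ u β Q) {v w : X × Z → ℝ}
    (hv : Continuous v) (hw : Continuous w)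
    (hfv : bellmanOp (separableAggregator u (fun z => β z) Q) Γ v = v)
    (hfw : bellmanOp (separableAggregator u (fun z => β z) Q) Γ w = w) : v = w := by
  funext s
  have h1 := h.isDominated_bellmanOp.tendsto_of_tendsto h.summable_norm_pow h.iUnion_exhaustion
    hv hw (exists_abs_sub_le_of_mem_locallyBounded (h.mem_locallyBounded hv)
      (h.mem_locallyBounded hw)) (s := s) (y := v s)
    (by simp only [Function.iterate_fixed hfv, tendsto_const_nhds_iff])
  simp only [Function.iterate_fixed hfw, tendsto_const_nhds_iff] at h1
  exact h1.symm

end IsFellerProgram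

end Program

/-! ### The main theorem. -/

theorem propositionp
    {X Z : Type*}
    [MetricSpace X] [MeasurableSpace X] [BorelSpace X]
    [MetricSpace Z] [CompactSpace Z] [MeasurableSpace Z] [BorelSpace Z]
    -- the exhaustion of `X` by compact sets
    (K : ℕ → Set X) (hK_mono : StrictMono K) (hK_compact : ∀ j, IsCompact (K j))
    (hK_cover : ⋃ j, interior (K j) = univ)
    (c : ℝ) (hc : 1 < c)
    -- the primitives
    (Γ : X × Z → Set X) (u : (X × Z) × X → ℝ) (β : BddMeas Z)
    (Q : Kernel Z Z) [IsMarkovKernel Q]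
    (hΓ_uhc : UpperHemicontinuous Γ) (hΓ_lhc : LowerHemicontinuous Γ)
    (hΓ_nonempty : ∀ s, (Γ s).Nonempty) (hΓ_compact : ∀ s, IsCompact (Γ s))
    (hβ_nonneg : ∀ z, 0 ≤ β z) (hβ_cont : Continuous (fun z => β z))
    (hu : ContinuousOn u (feasibleGraph Γ))
    (hQ : IsFeller Q)
    (hΓK : ∀ j, ∀ x ∈ K j, ∀ z, Γ (x, z) ⊆ K j)
    (r : ℝ) (hr : IsSpectralRadius (discountOp Q β) r) (hr_lt : r < 1) :
    -- the lifetime values and the value function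
    ∃ (val : (X × Z → X) → X × Z → ℝ) (vstar : X × Z → ℝ),
      -- all the integrals are of integrable functions and the lifetime values are well defined
      (∀ m, IsWeightSeq m → ∀ σ ∈ feasiblePolicies Γ,
        (∀ v₀ ∈ weightedSpace K c m, ∀ n x z,
          Integrable (fun z' => ((policyOp (separableAggregator u (fun z => β z) Q) σ)^[n] v₀) (x, z')) (Q z)) ∧
        IsPolicyValue (separableAggregator u (fun z => β z) Q) (weightedSpace K c m) σ (val σ)) ∧
      (∀ s, IsLUB ((fun σ => val σ s) '' feasiblePolicies Γ) (vstar s)) ∧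
      ∃ m, IsWeightSeq m ∧
        -- the value function is the unique fixed point of the Bellman operator on `C_m(S)`
        MapsTo (bellmanOp (separableAggregator u (fun z => β z) Q) Γ) (weightedSpace K c m) (weightedSpace K c m) ∧
        vstar ∈ weightedSpace K c m ∧ bellmanOp (separableAggregator u (fun z => β z) Q) Γ vstar = vstar ∧
        (∀ v ∈ weightedSpace K c m, bellmanOp (separableAggregator u (fun z => β z) Q) Γ v = v → v = vstar) ∧
        -- value iteration converges
        (∀ v ∈ weightedSpace K c m, Tendsto
          (fun n : ℕ => weightedNorm K c m ((bellmanOp (separableAggregator u (fun z => β z) Q) Γ)^[n] v - vstar)) atTop (𝓝 0)) ∧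
        -- an optimal stationary policy exists
        (∃ σ ∈ feasiblePolicies Γ, ∀ s, val σ s = vstar s) ∧
        -- the principle of optimality
        (∀ σ ∈ feasiblePolicies Γ, (∀ s, val σ s = vstar s) ↔
          ∀ s, IsMaxOn (fun a => separableAggregator u (fun z => β z) Q s a vstar) (Γ s) (σ s)) := by
  have h : IsFellerProgram K Γ u β Q :=
    ⟨hK_compact, hK_cover, hΓ_uhc, hΓ_lhc, hΓ_nonempty, hΓ_compact, hβ_nonneg, hβ_cont, hu, hQ,
      hΓK, hr.summable_norm_pow hr_lt⟩
  have hval : ∀ σ ∈ feasiblePolicies Γ, ∃ w,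
      IsPolicyValue (separableAggregator u (fun z => β z) Q) (locallyBounded K) σ w :=
    fun σ hσ => h.exists_policyValue hσ
  -- Outside the feasible policies `val` is arbitrary.
  choose! val hval using hval
  obtain ⟨w, hw, hfix, C, hC⟩ := h.exists_fixedPoint
  -- The weights are fitted to `T 0` alone; `hC` then carries membership over to `w`.
  obtain ⟨m, hm, hTm⟩ := exists_mem_weightedSpace hK_compact hK_mono.monotone hc
    (h.continuous_bellmanOp (v := fun _ => 0) continuous_const)
  have hwm : w ∈ weightedSpace K c m := mem_weightedSpace_of_localNorm_le hc hm hw hTm hC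
  have hopt : ∀ σ ∈ feasiblePolicies Γ, (∀ s, val σ s = w s) ↔
      policyOp (separableAggregator u (fun z => β z) Q) σ w = w := fun σ hσ =>
    funext_iff.symm.trans (h.policyValue_eq_iff hw hfix hσ (hval σ hσ))
  obtain ⟨τ, hτ, hτw⟩ := h.exists_greedy hw
  have hτval : ∀ s, val τ s = w s := (hopt τ hτ).2 (hτw.trans hfix)
  refine ⟨val, w, fun m' _ σ hσ => ⟨fun v₀ hv₀ n x z => ?_, fun v₀ hv₀ =>
    hval σ hσ v₀ (h.mem_locallyBounded hv₀.1)⟩, fun s => ⟨?_, fun b hb => ?_⟩, m, hm,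
    h.mapsTo_bellmanOp hc hm hTm, hwm, hfix,
    fun v hv hfv => h.fixedPoint_unique hv.1 hw hfv hfix,
    fun v hv => h.tendsto_weightedNorm_iterate hc hm hv hwm hfix, ⟨τ, hτ, hτval⟩,
    fun σ hσ => (hopt σ hσ).trans ?_⟩
  · obtain ⟨j, hj⟩ := mem_iUnion.1 (h.iUnion_exhaustion ▸ mem_univ x)
    exact integrable_of_mem_locallyBounded
      (((h.isDominated_policyOp hσ).iterate n).1 (h.mem_locallyBounded hv₀.1)) hj _
  · rintro _ ⟨σ, hσ, rfl⟩
    obtain ⟨h1, h2⟩ := h.policyValue_le hw hfix hσ (hval σ hσ)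
    exact (h2 s).trans (h1 s)
  · exact hτval s ▸ hb ⟨τ, hτ, rfl⟩
  · rw [funext_iff]
    refine forall_congr' fun s => ?_
    have hmax := h.isGreatest_bellmanOp hw s
    rw [hfix] at hmax
    constructor
    · intro heq a ha
      exact (hmax.2 ⟨a, ha, rfl⟩).trans_eq heq.symm
    · intro hs
      obtain ⟨a, ha, heq⟩ := hmax.1
      exact le_antisymm (hmax.2 ⟨σ s, hσ.2 s, rfl⟩) (heq.symm.trans_le (hs ha))
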